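/- A disk is a set $\{x\in\mathbb R^2 : |x-c|\le r\}$ with $c\in\mathbb R^2$, $r\in\mathbb R$. A set $\mathcal D$ of disks identifies a set $\mathcal P\subset\mathbb R^2$ if every point of $\mathcal P$ lies in some disk of $\mathcal D$ and, for any two distinct points of $\mathcal P$, some disk of $\mathcal D$ contains exactly one of them. For a finite set $\mathcal P$, let $\gamma(\mathcal P)$ be the minimum number of disks in a set of disks identifying $\mathcal P$. The inner faces of a set of circles are the bounded connected components of the complement in $\mathbb R^2$ of their union. Then: (1) For every set $\mathcal P$ of $n\ge 1$ points of $\mathbb R^2$, $\gamma(\mathcal P)\ \ge\ \left\lceil \frac{1+\sqrt{1+4(n-1)}}{2}\right\rceil$. (2) Any $k$ circles (of positive radius) form at most $k^2-k+1$ inner faces. (3) The bound in (1) is tight: for every $n\ge 1$ there is a set $\mathcal P$ of $n$ points of $\mathbb R^2$ with $\gamma(\mathcal P)=\left\lceil \frac{1+\sqrt{1+4(n-1)}}{2}\right\rceil$. (4) Let $k\ge 1$ and $\varepsilon>0$, and consider the $k$ disks of radius $1+\varepsilon$ centred at the vertices $(\cos\frac{2\pi i}{k},\sin\frac{2\pi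 i}{k})$, $0\le i<k$, of the regular $k$-gon inscribed in the unit circle (a single point for $k=1$, two antipodal points for $k=2$). Their boundary circles form exactly $k^2-k+1$ inner faces, and these $k$ disks identify every finite set $\mathcal P$ of points that lie in pairwise distinct inner faces. If moreover $\mathcal P$ has $n\ge1$ points and $k=\left\lceil \frac{1+\sqrt{1+4(n-1)}}{2}\right\rceil$, then $\gamma(\mathcal P)=k$. -/

import Mathlib

/-- The Euclidean plane. -/
abbrev Plane : Type := EuclideanSpace ℝ (Fin 2)

/-- A disk: the set of points at distance at most `r` of a centre `c`. -/
def IsDisk (d : Set Plane) : Prop :=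
  ∃ (c : Plane) (r : ℝ), d = Metric.closedBall c r

/-- A circle: the set of points at distance exactly `r` of a centre `c`, where `r > 0`. -/
def IsCircle (C : Set Plane) : Prop :=
  ∃ (c : Plane) (r : ℝ), 0 < r ∧ C = Metric.sphere c r

/-- `D` separates `p` and `q`: some member of `D` contains exactly one of them. -/
def Separates (D : Set (Set Plane)) (p q : Plane) : Prop :=
  ∃ d ∈ D, Xor (p ∈ d) (q ∈ d)

/-- `D` identifies `P`: each point of `P` is covered, each pair of points of `P` is separated. -/
def Identifies (D : Set (Set Plane)) (P : Set Plane) : Prop :=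
  (∀ p ∈ P, ∃ d ∈ D, p ∈ d) ∧ ∀ p ∈ P, ∀ q ∈ P, p ≠ q → Separates D p q

/-- The minimum number of disks needed to identify `P`
(the minimum exists for finite `P`, see `exists_identifying`). -/
noncomputable def idNumber (P : Set Plane) : ℕ :=
  sInf {k : ℕ | ∃ D : Finset (Set Plane),
    (∀ d ∈ D, IsDisk d) ∧ Identifies (↑D) P ∧ D.card = k}

theorem exists_identifying (P : Finset Plane) :
    ∃ D : Finset (Set Plane), (∀ d ∈ D, IsDisk d) ∧ Identifies (↑D) (↑P) := by
  classical
  refine ⟨P.image (fun p => ({p} : Set Plane)), ?_, ?_, ?_⟩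
  · intro d hd
    obtain ⟨p, -, rfl⟩ := Finset.mem_image.1 hd
    exact ⟨p, 0, by simp⟩
  · intro p hp
    exact ⟨{p}, by simpa using hp, rfl⟩
  · intro p hp q _ hpq
    exact ⟨{p}, by simpa using hp, Or.inl ⟨rfl, fun h => hpq h.symm⟩⟩

/-- The inner faces of an arrangement `Γ` of curves: the bounded connected components of the
complement of the union of `Γ`. -/
def innerFaces (Γ : Set (Set Plane)) : Set (Set Plane) :=
  {F | (∃ x ∈ (⋃₀ Γ)ᶜ, F = connectedComponentIn (⋃₀ Γ)ᶜ x) ∧ Bornology.IsBounded F}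

/-- The vertices of the regular `k`-gon inscribed in the unit circle, for `i < k`. -/
noncomputable def polygonVertex (k i : ℕ) : Plane :=
  !₂[Real.cos (2 * Real.pi * i / k), Real.sin (2 * Real.pi * i / k)]

/-- The disks of radius `1 + ε` centred on the vertices of the regular `k`-gon. -/
noncomputable def polygonDisks (k : ℕ) (ε : ℝ) : Set (Set Plane) :=
  {d | ∃ i < k, d = Metric.closedBall (polygonVertex k i) (1 + ε)}

/-- The boundary circles of the disks in `polygonDisks k ε`. -/
noncomputable def polygonCircles (k : ℕ) (ε : ℝ) : Set (Set Plane) :=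
  {C | ∃ i < k, C = Metric.sphere (polygonVertex k i) (1 + ε)}

/-- The number `⌈(1 + √(1 + 4 (n - 1))) / 2⌉`, meant for `n ≥ 1`. -/
noncomputable def diskBound (n : ℕ) : ℕ :=
  ⌈(1 + Real.sqrt (1 + 4 * ((n : ℝ) - 1))) / 2⌉₊

/-! Everything rests on counting the faces of a circle arrangement, done here by linear algebra. The
indicators of the components of an open set `U` are linearly independent in `locConst U`, so its
dimension bounds their number. When a circle `C` is removed from `U`, a locally constant function on
`U \ C` has a jump across `C`, which is locally constant on `C ∩ U`; if the jump vanishes, the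
function extends across `C`. Hence the dimension grows by at most that of `locConst (C ∩ U)`
(`rank_locConst_diff_sphere_le`). Since `C` meets each earlier circle at most twice, `j ≥ 1` earlier
circles cut it into at most `2j` arcs. Summation gives `k² - k + 2` faces for `k ≥ 1`, one of them
unbounded.

For the lower bound, radii are enlarged slightly so that no boundary passes through a point of `P`.
Identified points then lie in distinct inner faces, so `n ≤ k² - k + 1`, which is the stated bound
solved for `k`.

For sharpness, each proper nonempty cyclic interval of vertices of the `k`-gon is cut out by a point
lying in exactly those disks (`arcPoint`). With the origin, which lies in all disks, this gives `k(k
- 1) + 1` separated points, so the upper bound on inner faces is attained and each inner face holds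
exactly one of these points (`CircleSeparated.of_distinct_innerFaces`). -/

open Filter Topology Set

/-! ### Locally constant functions and the number of components -/

/-- The functions that are locally constant on `X` and vanish off `X`. -/
def locConst (X : Set Plane) : Submodule ℝ (Plane → ℝ) where
  carrier := {f | (∀ x ∉ X, f x = 0) ∧ ∀ x ∈ X, ∀ᶠ y in 𝓝[X] x, f y = f x}
  add_mem' := by
    rintro f g ⟨hf, hf'⟩ ⟨hg, hg'⟩
    refine ⟨fun x hx => by simp [hf x hx, hg x hx], fun x hx => ?_⟩
    filter_upwards [hf' x hx, hg' x hx] with y h1 h2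
    simp [h1, h2]
  zero_mem' := ⟨fun _ _ => rfl, fun _ _ => Eventually.of_forall fun _ => rfl⟩
  smul_mem' := by
    rintro a f ⟨hf, hf'⟩
    refine ⟨fun x hx => by simp [hf x hx], fun x hx => ?_⟩
    filter_upwards [hf' x hx] with y h1
    simp [h1]

theorem locConst_eq_of_isPreconnected {X A : Set Plane} {f : Plane → ℝ} (hf : f ∈ locConst X)
    (hA : IsPreconnected A) (hAX : A ⊆ X) {x y : Plane} (hx : x ∈ A) (hy : y ∈ A) :
    f x = f y := by
  refine hA.induction₂' (fun a b => f a = f b) (fun a ha => ?_) ?_ hx hy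
  · filter_upwards [nhdsWithin_mono a hAX (hf.2 a (hAX ha))] with b hb
    exact ⟨hb.symm, hb⟩
  · intro a b c _ _ _ h1 h2
    exact h1.trans h2

/-- If the values at finitely many points determine a function of `locConst X`, their number
bounds the dimension. -/
theorem rank_locConst_le_of_determined {X : Set Plane} {ι : Type} [Fintype ι] (p : ι → Plane)
    (h : ∀ f ∈ locConst X, (∀ i, f (p i) = 0) → f = 0) :
    Module.rank ℝ (locConst X) ≤ Fintype.card ι := by
  let e : locConst X →ₗ[ℝ] (ι → ℝ) :=
    { toFun := fun f i => f.1 (p i)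
      map_add' := fun _ _ => rfl
      map_smul' := fun _ _ => rfl }
  have he : Function.Injective e := by
    rw [← LinearMap.ker_eq_bot, LinearMap.ker_eq_bot']
    intro f hf
    exact Subtype.ext (h f.1 f.2 fun i => congrFun hf i)
  simpa using LinearMap.rank_le_of_injective e he

/-- The connected components of a set. -/
def faces (U : Set Plane) : Set (Set Plane) :=
  {F | ∃ x ∈ U, F = connectedComponentIn U x}

theorem faces_eq_of_mem {U F : Set Plane} (hF : F ∈ faces U) {x : Plane} (hx : x ∈ F) :
    F = connectedComponentIn U x := by
  obtain ⟨y, -, rfl⟩ := hF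
  exact connectedComponentIn_eq hx

theorem indicator_mem_locConst {U F : Set Plane} (hU : IsOpen U) (hF : F ∈ faces U) :
    F.indicator 1 ∈ locConst U := by
  have hFU : F ⊆ U := by
    obtain ⟨y, -, rfl⟩ := hF
    exact connectedComponentIn_subset U y
  refine ⟨fun x hx => indicator_of_notMem (fun h => hx (hFU h)) _, fun x hx => ?_⟩
  have hopen : IsOpen (connectedComponentIn U x) := hU.connectedComponentIn
  refine mem_nhdsWithin_of_mem_nhds ?_
  filter_upwards [hopen.mem_nhds (mem_connectedComponentIn hx)] with y hy
  have hiff : y ∈ F ↔ x ∈ F := by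
    constructor
    · intro h
      rw [faces_eq_of_mem hF h, ← connectedComponentIn_eq hy]
      exact mem_connectedComponentIn hx
    · intro h
      rw [faces_eq_of_mem hF h]
      exact hy
  by_cases h : x ∈ F
  · simp [h, hiff.2 h]
  · simp [h, mt hiff.1 h]

/-- Components are disjoint and nonempty, so evaluating a linear relation between their indicators
at a point of one component isolates its coefficient. -/
theorem encard_faces_le {U : Set Plane} (hU : IsOpen U) {n : ℕ}
    (h : Module.rank ℝ (locConst U) ≤ n) : (faces U).encard ≤ n := by
  let v : faces U → locConst U := fun F => ⟨F.1.indicator 1, indicator_mem_locConst hU F.2⟩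
  have hv : LinearIndependent ℝ v := by
    rw [linearIndependent_iff']
    intro s g hg F hFs
    obtain ⟨x, hx, hFx⟩ := F.2
    have hxF : x ∈ F.1 := hFx ▸ mem_connectedComponentIn hx
    have h0 := congrFun (congrArg Subtype.val hg) x
    simp only [Submodule.coe_sum, Submodule.coe_smul, Finset.sum_apply, Pi.smul_apply, v,
      smul_eq_mul] at h0
    rw [Finset.sum_eq_single F] at h0
    · simpa [hxF] using h0
    · intro G _ hGF
      rw [indicator_of_notMem, mul_zero]
      intro hxG
      exact hGF (Subtype.ext ((faces_eq_of_mem G.2 hxG).trans hFx.symm))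
    · exact fun h => absurd hFs h
  have h1 : Cardinal.mk (faces U) ≤ (n : Cardinal) := (hv.cardinal_le_rank).trans h
  exact Cardinal.toENat_le_natCast.2 h1

/-! ### The effect of removing one circle -/

theorem isPreconnected_dist_lt_iff {A : Set Plane} (hA : IsPreconnected A) {c : Plane} {r : ℝ}
    (hd : ∀ z ∈ A, dist z c ≠ r) {x y : Plane} (hx : x ∈ A) (hy : y ∈ A) :
    dist x c < r ↔ dist y c < r := by
  refine hA.induction₂' (fun a b => dist a c < r ↔ dist b c < r) (fun a ha => ?_) ?_ hx hy
  · refine mem_nhdsWithin_of_mem_nhds ?_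
    have hc : ContinuousAt (fun z => dist z c) a := by fun_prop
    rcases lt_or_gt_of_ne (hd a ha) with h | h
    · filter_upwards [hc.eventually (gt_mem_nhds h)] with b hb
      simp only [hb, h, and_self]
    · filter_upwards [hc.eventually (lt_mem_nhds h)] with b hb
      simp only [hb.not_gt, h.not_gt, and_self]
  · intro a b c _ _ _ h1 h2
    exact h1.trans h2

/-- Near a point of a circle, a function that is locally constant off the circle takes one value
on either side. -/
theorem exists_two_sided_nhd {U : Set Plane} (hU : IsOpen U) {c : Plane} {r : ℝ} (hr : 0 < r)
    {x : Plane} (hx : x ∈ Metric.sphere c r ∩ U) :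
    ∃ W ∈ 𝓝 x, W ⊆ U ∧ ∃ a b : Plane, ∀ f ∈ locConst (U \ Metric.sphere c r), ∀ z ∈ W,
      (r < dist z c → f z = f a) ∧ (dist z c < r → f z = f b) := by
  obtain ⟨hxC, hxU⟩ := hx
  obtain ⟨ε, hε, hεU⟩ := Metric.isOpen_iff.1 hU x hxU
  -- The neighbourhood is the ball of radius `η * r` about `x`. The base points of the two sides lie
  -- on the radial line through `x`, at distances `(1 ± η / 2) * r` from `c`. Each side is
  -- star-shaped about its base point.
  obtain ⟨η, hη0, hη1, hηε⟩ : ∃ η : ℝ, 0 < η ∧ η ≤ 1 / 2 ∧ η * r ≤ ε := by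
    refine ⟨min (1 / 2) (ε / r), by positivity, min_le_left _ _, ?_⟩
    calc min (1 / 2) (ε / r) * r ≤ ε / r * r := by gcongr; exact min_le_right _ _
      _ = ε := by field_simp
  have hxn : ‖x - c‖ = r := by rw [← dist_eq_norm]; exact hxC
  have hWU : Metric.ball x (η * r) ⊆ U := (Metric.ball_subset_ball hηε).trans hεU
  have hmem : ∀ s : ℝ, |s| < η → c + (1 + s) • (x - c) ∈ Metric.ball x (η * r) := by
    intro s hs
    have : c + (1 + s) • (x - c) - x = s • (x - c) := by module
    rw [Metric.mem_ball, dist_eq_norm, this, norm_smul, hxn, Real.norm_eq_abs]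
    gcongr
  have ha := hmem (η / 2) (by rw [abs_of_pos (by positivity)]; linarith)
  have hb := hmem (-(η / 2)) (by rw [abs_neg, abs_of_pos (by positivity)]; linarith)
  refine ⟨Metric.ball x (η * r), Metric.ball_mem_nhds _ (by positivity), hWU,
    c + (1 + η / 2) • (x - c), c + (1 + -(η / 2)) • (x - c), fun f hf z hz => ⟨fun hzr => ?_,
      fun hzr => ?_⟩⟩
  · refine locConst_eq_of_isPreconnected hf (convex_segment _ _).isPreconnected ?_
      (left_mem_segment ℝ z (c + (1 + η / 2) • (x - c))) (right_mem_segment ℝ _ _)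
    intro y hy
    refine ⟨hWU ((convex_ball x _).segment_subset hz ha hy), ?_⟩
    obtain ⟨α, β, hα, hβ, hαβ, rfl⟩ := hy
    have hz2 : r ^ 2 < ‖z - c‖ ^ 2 := by
      rw [← dist_eq_norm]
      gcongr
    have hzx : ‖z - x‖ ^ 2 < (η * r) ^ 2 := by
      rw [← dist_eq_norm]
      have := Metric.mem_ball.1 hz
      gcongr
    have hin : inner ℝ (z - c) (x - c) = (‖z - c‖ ^ 2 + r ^ 2 - ‖z - x‖ ^ 2) / 2 := by
      have h := norm_sub_sq_real (z - c) (x - c)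
      rw [sub_sub_sub_cancel_right, hxn] at h
      linarith
    have hexp : ‖α • z + β • (c + (1 + η / 2) • (x - c)) - c‖ ^ 2 =
        α ^ 2 * ‖z - c‖ ^ 2 + 2 * α * (β * (1 + η / 2)) * inner ℝ (z - c) (x - c) +
          (β * (1 + η / 2)) ^ 2 * r ^ 2 := by
      have : α • z + β • (c + (1 + η / 2) • (x - c)) - c =
          α • (z - c) + (β * (1 + η / 2)) • (x - c) := by
        obtain rfl : α = 1 - β := by linarith
        module
      rw [this, norm_add_sq_real, norm_smul, norm_smul, inner_smul_left, inner_smul_right, hxn,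
        mul_pow, mul_pow]
      simp only [Real.norm_eq_abs, sq_abs, conj_trivial]
      ring
    -- The outer side is not convex. Both ends of the segment are at distance more than `r` from
    -- `c`; once their inner product relative to `c` is at least `r ^ 2`, the squared distance along
    -- the segment is at least `(α + β) ^ 2 * r ^ 2 = r ^ 2`, and strictness comes from the ends.
    have h1 : r ^ 2 ≤ (1 + η / 2) * inner ℝ (z - c) (x - c) := by
      have h2 : r ^ 2 * (1 - η ^ 2 / 2) ≤ inner ℝ (z - c) (x - c) := by
        rw [hin]; nlinarith
      have h3 : 1 ≤ (1 + η / 2) * (1 - η ^ 2 / 2) := by nlinarith [mul_pos hη0 hη0]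
      calc r ^ 2 ≤ r ^ 2 * ((1 + η / 2) * (1 - η ^ 2 / 2)) :=
            le_mul_of_one_le_right (by positivity) h3
        _ = (1 + η / 2) * (r ^ 2 * (1 - η ^ 2 / 2)) := by ring
        _ ≤ _ := by gcongr
    have h2 : r ^ 2 < (1 + η / 2) ^ 2 * r ^ 2 :=
      lt_mul_of_one_lt_left (by positivity) (by nlinarith)
    intro hy
    have hy2 : ‖α • z + β • (c + (1 + η / 2) • (x - c)) - c‖ ^ 2 = r ^ 2 := by
      rw [← dist_eq_norm, Metric.mem_sphere.1 hy]
    rw [hexp] at hy2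
    have h4 : 0 ≤ 2 * α * β * ((1 + η / 2) * inner ℝ (z - c) (x - c) - r ^ 2) :=
      mul_nonneg (by positivity) (by linarith)
    have h5 : 0 ≤ α ^ 2 * (‖z - c‖ ^ 2 - r ^ 2) := mul_nonneg (by positivity) (by linarith)
    have h6 : 0 ≤ β ^ 2 * ((1 + η / 2) ^ 2 * r ^ 2 - r ^ 2) :=
      mul_nonneg (by positivity) (by linarith)
    have h7 : (α + β) ^ 2 * r ^ 2 = r ^ 2 := by rw [hαβ]; ring
    rcases hα.eq_or_lt with h0 | h0
    · obtain rfl : β = 1 := by linarith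
      rw [← h0] at hy2
      nlinarith
    · have h8 : 0 < α ^ 2 * (‖z - c‖ ^ 2 - r ^ 2) := mul_pos (by positivity) (by linarith)
      nlinarith
  · refine locConst_eq_of_isPreconnected hf (convex_segment _ _).isPreconnected ?_
      (left_mem_segment ℝ z (c + (1 + -(η / 2)) • (x - c))) (right_mem_segment ℝ _ _)
    intro y hy
    refine ⟨hWU ((convex_ball x _).segment_subset hz hb hy), ?_⟩
    have hbc : c + (1 + -(η / 2)) • (x - c) ∈ Metric.ball c r := by
      rw [Metric.mem_ball, dist_eq_norm, add_sub_cancel_left, norm_smul, hxn, Real.norm_eq_abs,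
        abs_of_pos (by linarith)]
      nlinarith
    have := (convex_ball c r).segment_subset (Metric.mem_ball.2 hzr) hbc hy
    exact fun h => absurd (Metric.mem_sphere.1 h) (Metric.mem_ball.1 this).ne

theorem exists_dist_gt_of_mem_nhds {c x : Plane} {r : ℝ} (hr : 0 < r) (hx : dist x c = r)
    {N : Set Plane} (hN : N ∈ 𝓝 x) :
    (∃ z ∈ N, r < dist z c) ∧ ∃ z ∈ N, dist z c < r := by
  have hcont : Tendsto (fun s : ℝ => c + (1 + s) • (x - c)) (𝓝 0) (𝓝 x) := by
    have : Continuous (fun s : ℝ => c + (1 + s) • (x - c)) := by fun_prop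
    simpa using this.tendsto 0
  have hev := hcont hN
  obtain ⟨δ, hδ, hδN⟩ := Metric.eventually_nhds_iff.1 hev
  have hdist : ∀ s : ℝ, -1 < s → dist (c + (1 + s) • (x - c)) c = (1 + s) * r := by
    intro s hs
    rw [dist_eq_norm, add_sub_cancel_left, norm_smul, ← dist_eq_norm, hx, Real.norm_eq_abs,
      abs_of_pos (by linarith)]
  have hm : 0 < min (δ / 2) (1 / 2) := by positivity
  have hm1 := min_le_left (δ / 2) (1 / 2)
  have hm2 := min_le_right (δ / 2) (1 / 2)
  refine ⟨⟨_, hδN (y := min (δ / 2) (1 / 2)) ?_, ?_⟩,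
    ⟨_, hδN (y := -min (δ / 2) (1 / 2)) ?_, ?_⟩⟩
  · rw [Real.dist_0_eq_abs, abs_of_pos hm]; linarith
  · rw [hdist _ (by linarith)]; nlinarith
  · rw [Real.dist_0_eq_abs, abs_neg, abs_of_pos hm]; linarith
  · rw [hdist _ (by linarith)]; nlinarith

/-- Rank-nullity for the jump map `J`: its range lies in `locConst (C ∩ U)`, and its kernel embeds
into `locConst U` by extension across the circle. -/
theorem rank_locConst_diff_sphere_le {U : Set Plane} (hU : IsOpen U) {c : Plane} {r : ℝ}
    (hr : 0 < r) :
    Module.rank ℝ (locConst (U \ Metric.sphere c r)) ≤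
      Module.rank ℝ (locConst U) + Module.rank ℝ (locConst (Metric.sphere c r ∩ U)) := by
  classical
  set C := Metric.sphere c r with hC
  choose! W hW hWU a b hab using fun x hx => exists_two_sided_nhd hU hr (x := x) hx
  -- The neighbourhoods of nearby points of the circle overlap on both sides of it, so the one-sided
  -- values are locally constant along the circle.
  have hside : ∀ x ∈ C ∩ U, ∀ y ∈ C ∩ U, y ∈ interior (W x) → ∀ f ∈ locConst (U \ C),
      f (a y) = f (a x) ∧ f (b y) = f (b x) := by
    intro x hx y hy hyx f hf
    have hN : W x ∩ W y ∈ 𝓝 y := inter_mem (mem_interior_iff_mem_nhds.1 hyx) (hW y hy)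
    obtain ⟨⟨z, hz, hzr⟩, w, hw, hwr⟩ := exists_dist_gt_of_mem_nhds hr hy.1 hN
    exact ⟨((hab y hy f hf z hz.2).1 hzr).symm.trans ((hab x hx f hf z hz.1).1 hzr),
      ((hab y hy f hf w hw.2).2 hwr).symm.trans ((hab x hx f hf w hw.1).2 hwr)⟩
  -- The jump: outer value minus inner value.
  let J : locConst (U \ C) →ₗ[ℝ] locConst (C ∩ U) :=
    { toFun := fun f => ⟨(C ∩ U).indicator fun x => f.1 (a x) - f.1 (b x),
        fun x hx => indicator_of_notMem hx _, fun x hx => by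
          have h1 : interior (W x) ∈ 𝓝[C ∩ U] x :=
            mem_nhdsWithin_of_mem_nhds (interior_mem_nhds.2 (hW x hx))
          filter_upwards [h1, self_mem_nhdsWithin] with y hy hyC
          obtain ⟨h2, h3⟩ := hside x hx y hyC hy f.1 f.2
          rw [indicator_of_mem hx, indicator_of_mem hyC, h2, h3]⟩
      map_add' := fun f g => by
        ext x
        by_cases hx : x ∈ C ∩ U
        · simp [indicator_of_mem hx]; ring
        · simp [indicator_of_notMem hx]
      map_smul' := fun s f => by
        ext x
        by_cases hx : x ∈ C ∩ U
        · simp [indicator_of_mem hx]; ring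
        · simp [indicator_of_notMem hx] }
  -- With zero jump the two one-sided values agree, and their common value fills in the circle.
  let E : LinearMap.ker J →ₗ[ℝ] locConst U :=
    { toFun := fun f => ⟨fun x => if x ∈ C ∩ U then f.1.1 (a x) else f.1.1 x, by
          intro x hx
          have h1 : x ∉ C ∩ U := fun h => hx h.2
          have h2 : x ∉ U \ C := fun h => hx h.1
          simp only [if_neg h1]
          exact f.1.2.1 x h2, by
          intro x hx
          refine mem_nhdsWithin_of_mem_nhds ?_
          by_cases hxC : x ∈ C
          · have hxCU : x ∈ C ∩ U := ⟨hxC, hx⟩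
            have h0 : f.1.1 (a x) = f.1.1 (b x) := by
              have h := congrFun (congrArg Subtype.val (LinearMap.mem_ker.1 f.2)) x
              simp only [J, LinearMap.coe_mk, AddHom.coe_mk, indicator_of_mem hxCU] at h
              exact sub_eq_zero.1 h
            filter_upwards [interior_mem_nhds.2 (hW x hxCU)] with y hy
            rw [if_pos hxCU]
            have hyW := interior_subset hy
            split_ifs with hyC
            · exact (hside x hxCU y hyC hy f.1.1 f.1.2).1
            · have hyC' : dist y c ≠ r := fun h => hyC ⟨h, hWU x hxCU hyW⟩
              rcases lt_or_gt_of_ne hyC' with h | h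
              · rw [h0]; exact (hab x hxCU f.1.1 f.1.2 y hyW).2 h
              · exact (hab x hxCU f.1.1 f.1.2 y hyW).1 h
          · have hopen : IsOpen (U \ C) := hU.sdiff Metric.isClosed_sphere
            have hxm : x ∈ U \ C := ⟨hx, hxC⟩
            have h1 := f.1.2.2 x hxm
            rw [hopen.nhdsWithin_eq hxm] at h1
            filter_upwards [h1, hopen.mem_nhds hxm] with y hy hyU
            have hxn : x ∉ C ∩ U := fun h => hxC h.1
            have hyn : y ∉ C ∩ U := fun h => hyU.2 h.1
            simp only [if_neg hxn, if_neg hyn, hy]⟩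
      map_add' := fun f g => by
        ext x
        by_cases hx : x ∈ C ∩ U <;> simp [hx, -mem_inter_iff]
      map_smul' := fun s f => by
        ext x
        by_cases hx : x ∈ C ∩ U <;> simp [hx, -mem_inter_iff] }
  have hE : Function.Injective E := by
    intro f g hfg
    refine Subtype.ext (Subtype.ext (funext fun x => ?_))
    have h := congrFun (congrArg Subtype.val hfg) x
    by_cases hx : x ∈ C ∩ U
    · exact (f.1.2.1 x fun h => h.2 hx.1).trans (g.1.2.1 x fun h => h.2 hx.1).symm
    · simpa only [E, LinearMap.coe_mk, AddHom.coe_mk, if_neg hx] using h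
  rw [← LinearMap.rank_range_add_rank_ker J, add_comm]
  exact add_le_add (LinearMap.rank_le_of_injective E hE) (Submodule.rank_le _)

/-! ### Arcs of a punctured circle -/

/-- The point at angle `θ` on the circle of centre `c` and radius `r`. -/
noncomputable def circlePoint (c : Plane) (r θ : ℝ) : Plane :=
  c + r • !₂[Real.cos θ, Real.sin θ]

theorem continuous_circlePoint (c : Plane) (r : ℝ) : Continuous (circlePoint c r) := by
  unfold circlePoint
  fun_prop

theorem circlePoint_mem_sphere (c : Plane) {r : ℝ} (hr : 0 < r) (θ : ℝ) :
    circlePoint c r θ ∈ Metric.sphere c r := by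
  have h : ‖(!₂[Real.cos θ, Real.sin θ] : Plane)‖ = 1 := by
    rw [EuclideanSpace.norm_eq]
    simp
  rw [circlePoint, Metric.mem_sphere, dist_eq_norm, add_sub_cancel_left, norm_smul, h,
    Real.norm_eq_abs, abs_of_pos hr, mul_one]

theorem exists_circlePoint_eq {c x : Plane} {r : ℝ} (hx : x ∈ Metric.sphere c r) :
    ∃ θ, circlePoint c r θ = x := by
  obtain ⟨z, hz0, hz1⟩ : ∃ z : ℂ, z.re = x 0 - c 0 ∧ z.im = x 1 - c 1 :=
    ⟨⟨x 0 - c 0, x 1 - c 1⟩, rfl, rfl⟩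
  have hzr : ‖z‖ = r := by
    rw [← Metric.mem_sphere.1 hx, EuclideanSpace.dist_eq, Complex.norm_def, Complex.normSq_apply]
    simp [hz0, hz1, Real.dist_eq, pow_two]
  have h0 := Complex.norm_mul_cos_arg z
  have h1 := Complex.norm_mul_sin_arg z
  rw [hzr] at h0 h1
  refine ⟨z.arg, ?_⟩
  ext i
  fin_cases i
  · simp [circlePoint, h0, hz0]
  · simp [circlePoint, h1, hz1]

theorem circlePoint_add_int (c : Plane) (r θ : ℝ) (n : ℤ) :
    circlePoint c r (θ + n * (2 * Real.pi)) = circlePoint c r θ := by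
  simp [circlePoint, Real.cos_add_int_mul_two_pi, Real.sin_add_int_mul_two_pi]

theorem exists_eq_add_int_of_circlePoint_eq {c : Plane} {r : ℝ} (hr : 0 < r) {θ ψ : ℝ}
    (h : circlePoint c r θ = circlePoint c r ψ) : ∃ n : ℤ, θ = ψ + n * (2 * Real.pi) := by
  have h' := smul_right_injective Plane hr.ne' (add_left_cancel h)
  have h0 : Real.cos θ = Real.cos ψ := by simpa using congrArg (fun v : Plane => v 0) h'
  have h1 : Real.sin θ = Real.sin ψ := by simpa using congrArg (fun v : Plane => v 1) h'
  obtain ⟨n, hn⟩ := Real.Angle.angle_eq_iff_two_pi_dvd_sub.1 (Real.Angle.cos_sin_inj h0 h1)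
  exact ⟨n, by linarith⟩

/-- Going backwards on a circle from a point off the finite set `S`, one meets a last
point of `S`. -/
theorem exists_preceding_point {c : Plane} {r : ℝ} {S : Finset Plane}
    (hS : S.Nonempty) (hSC : (S : Set Plane) ⊆ Metric.sphere c r) {θ : ℝ}
    (hθ : circlePoint c r θ ∉ S) :
    ∃ ψ < θ, circlePoint c r ψ ∈ S ∧ ∀ t ∈ Ioc ψ θ, circlePoint c r t ∉ S := by
  set T : Set ℝ := Iic θ ∩ circlePoint c r ⁻¹' S with hT
  have hTc : IsClosed T :=
    isClosed_Iic.inter (S.finite_toSet.isClosed.preimage (continuous_circlePoint c r))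
  have hTb : BddAbove T := ⟨θ, fun t ht => ht.1⟩
  have hTn : T.Nonempty := by
    obtain ⟨p, hp⟩ := hS
    obtain ⟨φ, rfl⟩ := exists_circlePoint_eq (hSC hp)
    obtain ⟨n, hn⟩ := exists_nat_ge ((φ - θ) / (2 * Real.pi))
    rw [div_le_iff₀ Real.two_pi_pos] at hn
    refine ⟨φ + ((-n : ℤ) : ℝ) * (2 * Real.pi), ?_, ?_⟩
    · simp only [mem_Iic]
      push_cast
      linarith
    · rw [mem_preimage, circlePoint_add_int]
      exact hp
  have hmem := hTc.csSup_mem hTn hTb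
  refine ⟨sSup T, lt_of_le_of_ne hmem.1 fun h => hθ (h ▸ hmem.2), hmem.2, fun t ht htS => ?_⟩
  exact absurd (le_csSup hTb ⟨ht.2, htS⟩) (not_le.2 ht.1)

/-- Each point off `S` belongs to the arc that starts at the last point of `S` before it, so one
sample per point of `S` determines the function. -/
theorem rank_locConst_sphere_diff_le {c : Plane} {r : ℝ} (hr : 0 < r) {S : Finset Plane}
    (hS : S.Nonempty) (hSC : (S : Set Plane) ⊆ Metric.sphere c r) :
    Module.rank ℝ (locConst (Metric.sphere c r \ S)) ≤ S.card := by
  classical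
  let Q : Plane → Plane → Prop := fun p x => ∃ ψ θ : ℝ, ψ < θ ∧ circlePoint c r ψ = p ∧
    circlePoint c r θ = x ∧ ∀ t ∈ Ioc ψ θ, circlePoint c r t ∉ S
  have hQ : ∀ p x y, Q p x → Q p y → ∀ f ∈ locConst (Metric.sphere c r \ S), f x = f y := by
    rintro p x y ⟨ψ, θ, hlt, rfl, rfl, hfree⟩ ⟨ψ', θ', hlt', hψ, rfl, hfree'⟩ f hf
    obtain ⟨n, rfl⟩ := exists_eq_add_int_of_circlePoint_eq hr hψ
    have hpre : IsPreconnected (circlePoint c r '' Ioc ψ (max θ (θ' - n * (2 * Real.pi)))) :=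
      isPreconnected_Ioc.image _ (continuous_circlePoint c r).continuousOn
    refine locConst_eq_of_isPreconnected hf hpre ?_ ⟨θ, ⟨hlt, le_max_left _ _⟩, rfl⟩
      ⟨θ' - n * (2 * Real.pi), ⟨by linarith, le_max_right _ _⟩, ?_⟩
    · rintro _ ⟨t, ⟨ht1, ht2⟩, rfl⟩
      refine ⟨circlePoint_mem_sphere c hr t, ?_⟩
      rcases le_max_iff.1 ht2 with h | h
      · exact hfree t ⟨ht1, h⟩
      · rw [← circlePoint_add_int c r t n]
        exact hfree' _ ⟨by linarith, by linarith⟩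
    · rw [← circlePoint_add_int c r _ n, sub_add_cancel]
  -- The default `p` is never consulted: a sample is used only for an arc already known to contain a
  -- point.
  let rep : S → Plane := fun p => if h : ∃ x, Q p x then h.choose else p
  have h := rank_locConst_le_of_determined (X := Metric.sphere c r \ S) rep ?_
  · simpa using h
  · intro f hf h0
    funext x
    by_cases hx : x ∈ Metric.sphere c r \ S
    · obtain ⟨θ, rfl⟩ := exists_circlePoint_eq hx.1
      obtain ⟨ψ, hψ, hψS, hfree⟩ := exists_preceding_point hS hSC hx.2
      have hex : ∃ x, Q (circlePoint c r ψ) x := ⟨_, ψ, θ, hψ, rfl, rfl, hfree⟩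
      have h1 := h0 ⟨_, hψS⟩
      simp only [rep, dif_pos hex] at h1
      rw [Pi.zero_apply, ← h1]
      exact hQ _ _ _ ⟨ψ, θ, hψ, rfl, rfl, hfree⟩ hex.choose_spec f hf
    · exact hf.1 x hx

/-! ### Counting the faces of an arrangement -/

theorem one_lt_rank_plane : 1 < Module.rank ℝ Plane := by
  rw [← Module.finrank_eq_rank, finrank_euclideanSpace_fin]
  norm_num

theorem rank_locConst_le_one {X : Set Plane} (hX : IsPreconnected X) :
    Module.rank ℝ (locConst X) ≤ 1 := by
  classical
  let x₀ : Plane := if h : X.Nonempty then h.choose else 0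
  have h := rank_locConst_le_of_determined (X := X) (fun _ : Unit => x₀) ?_
  · simpa using h
  · intro f hf h0
    funext x
    by_cases hx : x ∈ X
    · have hne : X.Nonempty := ⟨x, hx⟩
      have h1 := h0 ()
      simp only [x₀, dif_pos hne] at h1
      rw [Pi.zero_apply, ← h1]
      exact locConst_eq_of_isPreconnected hf hX Subset.rfl hx hne.choose_spec
    · exact hf.1 x hx

theorem exists_finset_eq_inter_of_isCircle {C C' : Set Plane} (hC : IsCircle C) (hC' : IsCircle C')
    (hne : C ≠ C') : ∃ t : Finset Plane, (t : Set Plane) = C ∩ C' ∧ t.card ≤ 2 := by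
  classical
  obtain ⟨c, r, hr, rfl⟩ := hC
  obtain ⟨c', r', hr', rfl⟩ := hC'
  rcases (Metric.sphere c r ∩ Metric.sphere c' r').subsingleton_or_nontrivial with h | h
  · rcases h.eq_empty_or_singleton with h | ⟨a, h⟩
    · exact ⟨∅, by simp [h], by simp⟩
    · exact ⟨{a}, by simp [h], by simp⟩
  · obtain ⟨a, ha, b, hb, hab⟩ := h
    have hcc : c ≠ c' := by
      rintro rfl
      have : r = r' := (Metric.mem_sphere.1 ha.1).symm.trans (Metric.mem_sphere.1 ha.2)
      exact hne (by rw [this])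
    refine ⟨{a, b}, ?_, Finset.card_le_two⟩
    ext x
    simp only [Finset.coe_insert, Finset.coe_singleton, mem_insert_iff, mem_singleton_iff]
    constructor
    · rintro (rfl | rfl) <;> assumption
    · intro hx
      exact EuclideanGeometry.eq_of_dist_eq_of_dist_eq_of_finrank_eq_two
        finrank_euclideanSpace_fin hcc hab ha.1 hb.1 hx.1 ha.2 hb.2 hx.2

theorem isClosed_sUnion_circles {Γ : Finset (Set Plane)} (hΓ : ∀ C ∈ Γ, IsCircle C) :
    IsClosed (⋃₀ (Γ : Set (Set Plane))) := by
  rw [sUnion_eq_biUnion]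
  refine Γ.finite_toSet.isClosed_biUnion fun C hC => ?_
  obtain ⟨c, r, -, rfl⟩ := hΓ C hC
  exact Metric.isClosed_sphere

/-- Distinct circles share at most two points, so at most `2 * Γ.card` points are removed from `C`.
A circle with no point removed is still one piece, hence the `max`. -/
theorem rank_locConst_inter_compl_le {Γ : Finset (Set Plane)} (hΓ : ∀ C ∈ Γ, IsCircle C)
    {C : Set Plane} (hC : IsCircle C) (hCΓ : C ∉ Γ) :
    Module.rank ℝ (locConst (C ∩ (⋃₀ (Γ : Set (Set Plane)))ᶜ)) ≤
      (max 1 (2 * Γ.card) : ℕ) := by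
  classical
  choose! t ht htc using fun C' (hC' : C' ∈ Γ) => exists_finset_eq_inter_of_isCircle hC
    (hΓ C' hC') (fun h => hCΓ (h ▸ hC'))
  set S := Γ.biUnion t with hS
  have hSC : (S : Set Plane) ⊆ C := by
    intro x hx
    obtain ⟨C', hC', hx⟩ := Finset.mem_biUnion.1 (Finset.mem_coe.1 hx)
    rw [← Finset.mem_coe, ht C' hC'] at hx
    exact hx.1
  have hset : C ∩ (⋃₀ (Γ : Set (Set Plane)))ᶜ = C \ S := by
    ext x
    refine and_congr_right fun hx => not_congr ?_
    rw [Finset.mem_coe, hS, Finset.mem_biUnion]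
    refine exists_congr fun C' => and_congr_right fun hC' => ?_
    rw [← Finset.mem_coe, ht C' hC']
    exact ⟨fun h => ⟨hx, h⟩, fun h => h.2⟩
  rw [hset]
  obtain ⟨c, r, hr, rfl⟩ := hC
  rcases S.eq_empty_or_nonempty with h | h
  · rw [h, Finset.coe_empty, sdiff_empty]
    refine (rank_locConst_le_one (isPreconnected_sphere one_lt_rank_plane c r)).trans ?_
    exact_mod_cast le_max_left 1 (2 * Γ.card)
  · refine (rank_locConst_sphere_diff_le hr h hSC).trans ?_
    have h1 : S.card ≤ Γ.card * 2 := Finset.card_biUnion_le_card_mul _ _ _ htc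
    exact_mod_cast (h1.trans_eq (mul_comm _ _)).trans (le_max_right 1 _)

/-- The increments `2, 4, …, 2(k - 1)` sum to `k(k - 1)`. The term `min 2 (Γ.card + 1)` is `1` for
the bare plane and `2` from the first circle on, which adds one face without meeting anything. -/
theorem rank_locConst_compl_circles_le (Γ : Finset (Set Plane)) (hΓ : ∀ C ∈ Γ, IsCircle C) :
    Module.rank ℝ (locConst (⋃₀ (Γ : Set (Set Plane)))ᶜ) ≤
      (Γ.card * (Γ.card - 1) + min 2 (Γ.card + 1) : ℕ) := by
  classical
  induction Γ using Finset.induction_on with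
  | empty =>
    rw [Finset.coe_empty, sUnion_empty, compl_empty]
    simpa using rank_locConst_le_one isPreconnected_univ
  | insert C Γ hC ih =>
    have hΓ' : ∀ C' ∈ Γ, IsCircle C' := fun C' h => hΓ C' (Finset.mem_insert_of_mem h)
    have hCc := hΓ C (Finset.mem_insert_self C Γ)
    have h1 := ih hΓ'
    have h2 := rank_locConst_inter_compl_le hΓ' hCc hC
    have hset : (⋃₀ ((insert C Γ : Finset (Set Plane)) : Set (Set Plane)))ᶜ =
        (⋃₀ (Γ : Set (Set Plane)))ᶜ \ C := by
      rw [Finset.coe_insert, sUnion_insert, compl_union, inter_comm]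
      rfl
    rw [hset]
    obtain ⟨c, r, hr, rfl⟩ := hCc
    refine (rank_locConst_diff_sphere_le (isClosed_sUnion_circles hΓ').isOpen_compl hr).trans ?_
    refine (add_le_add h1 h2).trans ?_
    rw [Finset.card_insert_of_notMem hC]
    have h3 : Γ.card * (Γ.card - 1) + min 2 (Γ.card + 1) + max 1 (2 * Γ.card) ≤
        (Γ.card + 1) * (Γ.card + 1 - 1) + min 2 (Γ.card + 1 + 1) := by
      rcases Γ.card with _ | m
      · simp
      · simp only [Nat.add_sub_cancel]
        have e1 : min 2 (m + 1 + 1) = 2 := by omega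
        have e2 : min 2 (m + 1 + 1 + 1) = 2 := by omega
        have e3 : max 1 (2 * (m + 1)) = 2 * (m + 1) := by omega
        rw [e1, e2, e3]
        nlinarith
    exact_mod_cast h3

/-- Finitely many circles leave an unbounded face. -/
theorem exists_unbounded_face {Γ : Finset (Set Plane)} (hΓ : ∀ C ∈ Γ, IsCircle C) :
    ∃ F ∈ faces (⋃₀ (Γ : Set (Set Plane)))ᶜ, ¬ Bornology.IsBounded F := by
  have hb : Bornology.IsBounded (⋃₀ (Γ : Set (Set Plane))) := by
    rw [Bornology.isBounded_sUnion Γ.finite_toSet]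
    intro C hC
    obtain ⟨c, r, -, rfl⟩ := hΓ C hC
    exact Metric.isBounded_sphere
  obtain ⟨R, hR0, hR⟩ := hb.subset_ball_lt 0 0
  have he : ‖EuclideanSpace.single (0 : Fin 2) (1 : ℝ)‖ = 1 := by simp
  set e : Plane := EuclideanSpace.single (0 : Fin 2) (1 : ℝ)
  have hray : (fun t : ℝ => t • e) '' Ici R ⊆ (⋃₀ (Γ : Set (Set Plane)))ᶜ := by
    rintro _ ⟨t, ht, rfl⟩ hmem
    have h1 := mem_ball_zero_iff.1 (hR hmem)
    rw [norm_smul, he, mul_one, Real.norm_eq_abs] at h1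
    exact absurd ((le_abs_self t).trans_lt h1) (not_lt.2 ht)
  have hpre : IsPreconnected ((fun t : ℝ => t • e) '' Ici R) :=
    isPreconnected_Ici.image _ (by fun_prop)
  have hmem : R • e ∈ (fun t : ℝ => t • e) '' Ici R := ⟨R, self_mem_Ici, rfl⟩
  refine ⟨_, ⟨R • e, hray hmem, rfl⟩, fun hbd => ?_⟩
  obtain ⟨M, hM⟩ := hbd.exists_norm_le
  have h2 := hM _ (hpre.subset_connectedComponentIn hmem hray
    ⟨max R (|M| + 1), mem_Ici.2 (le_max_left _ _), rfl⟩)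
  simp only [norm_smul, he, mul_one, Real.norm_eq_abs] at h2
  have h3 := (le_max_right R (|M| + 1)).trans (le_abs_self _)
  have h4 := le_abs_self M
  linarith

theorem encard_innerFaces_le (Γ : Finset (Set Plane)) (hΓ : ∀ C ∈ Γ, IsCircle C) :
    (innerFaces (Γ : Set (Set Plane))).encard ≤ ((Γ.card ^ 2 - Γ.card + 1 : ℕ) : ℕ∞) := by
  have h1 := encard_faces_le (isClosed_sUnion_circles hΓ).isOpen_compl
    (rank_locConst_compl_circles_le Γ hΓ)
  obtain ⟨F, hF, hFb⟩ := exists_unbounded_face hΓ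
  have hnot : F ∉ innerFaces (Γ : Set (Set Plane)) := fun h => hFb h.2
  have hsub : insert F (innerFaces (Γ : Set (Set Plane))) ⊆ faces (⋃₀ (Γ : Set (Set Plane)))ᶜ :=
    insert_subset hF fun G hG => hG.1
  have h2 := (encard_le_encard hsub).trans h1
  rw [encard_insert_of_notMem hnot] at h2
  have h3 : Γ.card * (Γ.card - 1) + min 2 (Γ.card + 1) ≤ Γ.card ^ 2 - Γ.card + 1 + 1 := by
    rw [Nat.mul_sub, pow_two, mul_one]
    omega
  have h4 := h2.trans (Nat.cast_le.2 h3)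
  rw [Nat.cast_add _ 1, Nat.cast_one] at h4
  exact (ENat.add_le_add_iff_right ENat.one_ne_top).1 h4

/-! ### From faces to the lower bound -/

theorem diskBound_le_iff {n k : ℕ} (hk : 1 ≤ k) : diskBound n ≤ k ↔ n ≤ k ^ 2 - k + 1 := by
  have hk' : (1 : ℝ) ≤ k := by exact_mod_cast hk
  have hkk : k ≤ k ^ 2 := Nat.le_self_pow (by norm_num) k
  have hcast : ((k ^ 2 - k + 1 : ℕ) : ℝ) = (k : ℝ) ^ 2 - k + 1 := by
    push_cast [Nat.cast_sub hkk]
    ring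
  rw [diskBound, Nat.ceil_le, div_le_iff₀ two_pos, ← le_sub_iff_add_le',
    Real.sqrt_le_left (by linarith), ← Nat.cast_le (α := ℝ), hcast]
  constructor <;> intro h <;> nlinarith

theorem one_le_diskBound (n : ℕ) : 1 ≤ diskBound n := by
  rw [diskBound, Nat.one_le_ceil_iff]
  positivity

theorem idNumber_le {P : Set Plane} {D : Finset (Set Plane)} (hD : ∀ d ∈ D, IsDisk d)
    (h : Identifies (↑D) P) : idNumber P ≤ D.card :=
  Nat.sInf_le ⟨D, hD, h, rfl⟩

/-- On a finite set, every disk has the same trace as some disk of positive radius whose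
boundary avoids the set. -/
theorem exists_trace_eq (P : Finset Plane) {d : Set Plane} (hd : IsDisk d) :
    ∃ (c : Plane) (r : ℝ), 0 < r ∧ ∀ p ∈ P, dist p c ≠ r ∧ (p ∈ d ↔ dist p c < r) := by
  obtain ⟨c, r, hr, h⟩ : ∃ (c : Plane) (r : ℝ), 0 ≤ r ∧ ∀ p ∈ P, p ∈ d ↔ dist p c ≤ r := by
    obtain ⟨c, r, rfl⟩ := hd
    -- A negative radius gives the empty disk; a single point off `P` has the same trace.
    rcases le_or_gt 0 r with hr | hr
    · exact ⟨c, r, hr, fun p _ => Iff.rfl⟩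
    · obtain ⟨c', hc'⟩ := Infinite.exists_notMem_finset P
      refine ⟨c', 0, le_rfl, fun p hp => ?_⟩
      rw [Metric.closedBall_eq_empty.2 hr]
      simp only [mem_empty_iff_false, dist_le_zero, false_iff]
      rintro rfl
      exact hc' hp
  -- A slightly larger radius keeps the trace, and it clears the points on the old boundary.
  have hev : ∀ᶠ s in 𝓝[>] r, ∀ p ∈ P, dist p c ≠ s ∧ (p ∈ d ↔ dist p c < s) := by
    rw [Finset.eventually_all]
    intro p hp
    rw [h p hp]
    rcases le_or_gt (dist p c) r with hpr | hpr
    · filter_upwards [self_mem_nhdsWithin] with s hs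
      have : dist p c < s := hpr.trans_lt hs
      exact ⟨this.ne, iff_of_true hpr this⟩
    · filter_upwards [mem_nhdsWithin_of_mem_nhds (gt_mem_nhds hpr)] with s hs
      exact ⟨ne_of_gt hs, iff_of_false hpr.not_ge (not_lt.2 (le_of_lt hs))⟩
  obtain ⟨s, hs, hsr⟩ := (hev.and self_mem_nhdsWithin).exists
  exact ⟨c, s, hr.trans_lt hsr, hs⟩

/-- The circles with given centres and radii. -/
def circles (I : Set (Plane × ℝ)) : Set (Set Plane) :=
  (fun x => Metric.sphere x.1 x.2) '' I

theorem mem_compl_sUnion_circles {I : Set (Plane × ℝ)} {p : Plane} :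
    p ∈ (⋃₀ circles I)ᶜ ↔ ∀ x ∈ I, dist p x.1 ≠ x.2 := by
  simp [circles, dist_eq_norm]

theorem dist_lt_iff_of_mem_component {I : Set (Plane × ℝ)} {x : Plane × ℝ} (hx : x ∈ I)
    {p q z : Plane} (hp : p ∈ connectedComponentIn (⋃₀ circles I)ᶜ z)
    (hq : q ∈ connectedComponentIn (⋃₀ circles I)ᶜ z) : dist p x.1 < x.2 ↔ dist q x.1 < x.2 :=
  isPreconnected_dist_lt_iff isPreconnected_connectedComponentIn
    (fun _ hw => mem_compl_sUnion_circles.1 (connectedComponentIn_subset _ _ hw) x hx) hp hq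

/-- Each point of `P` is off all the circles and inside some circle, and any two of them are on
different sides of some circle. -/
structure CircleSeparated (I : Set (Plane × ℝ)) (P : Set Plane) : Prop where
  avoids : P ⊆ (⋃₀ circles I)ᶜ
  covers : ∀ p ∈ P, ∃ x ∈ I, dist p x.1 < x.2
  separates : ∀ p ∈ P, ∀ q ∈ P, p ≠ q → ∃ x ∈ I, ¬ (dist p x.1 < x.2 ↔ dist q x.1 < x.2)

namespace CircleSeparated

variable {I : Set (Plane × ℝ)} {P : Set Plane}

/-- A face cannot cross a circle, so the face of a covered point stays inside the covering disk and
is bounded. -/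
theorem mapsTo (h : CircleSeparated I P) :
    MapsTo (connectedComponentIn (⋃₀ circles I)ᶜ) P (innerFaces (circles I)) := by
  intro p hp
  obtain ⟨x, hx, hpx⟩ := h.covers p hp
  exact ⟨⟨p, h.avoids hp, rfl⟩, (Metric.isBounded_ball (x := x.1) (r := x.2)).subset fun _ hy =>
    (dist_lt_iff_of_mem_component hx hy (mem_connectedComponentIn (h.avoids hp))).2 hpx⟩

theorem injOn (h : CircleSeparated I P) :
    InjOn (connectedComponentIn (⋃₀ circles I)ᶜ) P := by
  intro p hp q hq hpq
  by_contra hne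
  obtain ⟨x, hx, hpx⟩ := h.separates p hp q hq hne
  refine hpx (dist_lt_iff_of_mem_component hx (mem_connectedComponentIn (h.avoids hp)) ?_)
  rw [hpq]
  exact mem_connectedComponentIn (h.avoids hq)

theorem encard_le (h : CircleSeparated I P) : P.encard ≤ (innerFaces (circles I)).encard :=
  encard_le_encard_of_injOn h.mapsTo h.injOn

theorem mono {Q : Set Plane} (h : CircleSeparated I Q) (hPQ : P ⊆ Q) : CircleSeparated I P :=
  ⟨hPQ.trans h.avoids, fun p hp => h.covers p (hPQ hp),
    fun p hp q hq => h.separates p (hPQ hp) q (hPQ hq)⟩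

/-- If there are as many separated points as inner faces, then any points in distinct inner faces
are separated. -/
theorem of_distinct_innerFaces {Q : Finset Plane} (hQ : CircleSeparated I (Q : Set Plane))
    (hcard : (innerFaces (circles I)).encard ≤ Q.card)
    (hP : ∀ p ∈ P, ∃ F ∈ innerFaces (circles I), p ∈ F)
    (hPF : ∀ F ∈ innerFaces (circles I), ∀ p ∈ P, ∀ q ∈ P, p ∈ F → q ∈ F → p = q) :
    CircleSeparated I P := by
  set g := connectedComponentIn (⋃₀ circles I)ᶜ with hg
  -- An injection into a set that is no larger is onto: every inner face contains a point of `Q`,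
  -- which can then stand in for any point of that face.
  have himage : g '' Q = innerFaces (circles I) := by
    refine (Q.finite_toSet.image g).eq_of_subset_of_encard_le hQ.mapsTo.image_subset ?_
    rw [hQ.injOn.encard_image, encard_coe_eq_coe_finsetCard]
    exact hcard
  have hrep : ∀ p ∈ P, ∃ q ∈ Q, p ∈ g q ∧ ∀ x ∈ I, (dist p x.1 < x.2 ↔ dist q x.1 < x.2) := by
    intro p hp
    obtain ⟨F, hF, hpF⟩ := hP p hp
    rw [← himage] at hF
    obtain ⟨q, hq, rfl⟩ := hF
    exact ⟨q, hq, hpF, fun x hx =>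
      dist_lt_iff_of_mem_component hx hpF (mem_connectedComponentIn (hQ.avoids hq))⟩
  refine ⟨fun p hp => ?_, fun p hp => ?_, fun p hp p' hp' hne => ?_⟩
  · obtain ⟨q, -, hpq, -⟩ := hrep p hp
    exact connectedComponentIn_subset _ _ hpq
  · obtain ⟨q, hq, -, hpq⟩ := hrep p hp
    obtain ⟨x, hx, hqx⟩ := hQ.covers q hq
    exact ⟨x, hx, (hpq x hx).2 hqx⟩
  · obtain ⟨q, hq, hpg, hpq⟩ := hrep p hp
    obtain ⟨q', hq', hpg', hpq'⟩ := hrep p' hp'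
    have hqq : q ≠ q' := by
      rintro rfl
      exact hne (hPF _ (hQ.mapsTo hq) p hp p' hp' hpg hpg')
    obtain ⟨x, hx, hsep⟩ := hQ.separates q hq q' hq' hqq
    refine ⟨x, hx, ?_⟩
    rw [hpq x hx, hpq' x hx]
    exact hsep

end CircleSeparated

theorem card_le_of_identifies {P : Finset Plane} {D : Finset (Set Plane)}
    (hD : ∀ d ∈ D, IsDisk d) (h : Identifies (↑D) (↑P : Set Plane)) :
    P.card ≤ D.card ^ 2 - D.card + 1 := by
  classical
  choose! c r hr hcr using fun d hd => exists_trace_eq P (hD d hd)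
  have hsep : CircleSeparated ((fun d => (c d, r d)) '' (D : Set (Set Plane))) (P : Set Plane) := by
    refine ⟨fun p hp => mem_compl_sUnion_circles.2 ?_, ?_, ?_⟩
    · rintro _ ⟨d, hd, rfl⟩
      exact (hcr d hd p hp).1
    · intro p hp
      obtain ⟨d, hd, hpd⟩ := h.1 p hp
      exact ⟨_, ⟨d, hd, rfl⟩, (hcr d hd p hp).2.1 hpd⟩
    · intro p hp q hq hpq
      obtain ⟨d, hd, hx⟩ := h.2 p hp q hq hpq
      refine ⟨_, ⟨d, hd, rfl⟩, ?_⟩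
      rw [← (hcr d hd p hp).2, ← (hcr d hd q hq).2, ← xor_iff_not_iff]
      exact hx
  set Γ : Finset (Set Plane) := D.image fun d => Metric.sphere (c d) (r d) with hΓ
  have hcirc : ∀ C ∈ Γ, IsCircle C := by
    intro C hC
    obtain ⟨d, hd, rfl⟩ := Finset.mem_image.1 hC
    exact ⟨_, _, hr d hd, rfl⟩
  have hΓI : circles ((fun d => (c d, r d)) '' (D : Set (Set Plane))) = Γ := by
    rw [circles, image_image, hΓ, Finset.coe_image]
  have h1 := hsep.encard_le
  rw [hΓI] at h1
  replace h1 := h1.trans (encard_innerFaces_le Γ hcirc)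
  rw [encard_coe_eq_coe_finsetCard, Nat.cast_le] at h1
  -- Different disks may be assigned the same circle, so the bound is transferred by monotonicity of
  -- `k * (k - 1)`.
  have h2 : Γ.card ≤ D.card := Finset.card_image_le
  have h3 : Γ.card * (Γ.card - 1) ≤ D.card * (D.card - 1) :=
    Nat.mul_le_mul h2 (Nat.sub_le_sub_right h2 1)
  rw [Nat.mul_sub, Nat.mul_sub, mul_one, mul_one, ← pow_two, ← pow_two] at h3
  omega

theorem diskBound_le_idNumber {P : Finset Plane} (hP : P.Nonempty) :
    diskBound P.card ≤ idNumber (↑P : Set Plane) := by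
  obtain ⟨D₀, hD₀, h₀⟩ := exists_identifying P
  refine le_csInf ⟨_, D₀, hD₀, h₀, rfl⟩ ?_
  rintro _ ⟨D, hD, h, rfl⟩
  obtain ⟨p, hp⟩ := hP
  obtain ⟨d, hd, -⟩ := h.1 p hp
  exact (diskBound_le_iff (Finset.card_pos.2 ⟨d, hd⟩)).2 (card_le_of_identifies hD h)

/-! ### The disks on a regular polygon -/

theorem polygonVertex_add_self {k : ℕ} (hk : 1 ≤ k) (i : ℕ) :
    polygonVertex k (i + k) = polygonVertex k i := by
  have hk' : (k : ℝ) ≠ 0 := by positivity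
  have h : 2 * Real.pi * ((i + k : ℕ) : ℝ) / k = 2 * Real.pi * i / k + 2 * Real.pi := by
    push_cast
    field_simp
  rw [polygonVertex, h, Real.cos_add_two_pi, Real.sin_add_two_pi, polygonVertex]

theorem polygonVertex_mod {k : ℕ} (hk : 1 ≤ k) (i : ℕ) :
    polygonVertex k (i % k) = polygonVertex k i :=
  (show Function.Periodic (polygonVertex k) k from polygonVertex_add_self hk).map_mod_nat i

theorem exists_lt_polygonVertex_add_eq {k : ℕ} (hk : 1 ≤ k) (s i : ℕ) :
    ∃ j < k, polygonVertex k (s + j) = polygonVertex k i := by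
  refine ⟨(i + (k - s % k)) % k, Nat.mod_lt _ hk, ?_⟩
  rw [← polygonVertex_mod hk, ← polygonVertex_mod hk i, Nat.add_mod_mod]
  congr 1
  have h := Nat.mod_lt s hk
  have h2 : s + (i + (k - s % k)) = i + k * (s / k + 1) := by
    have := Nat.mod_add_div s k
    rw [mul_add, mul_one]
    omega
  rw [h2, Nat.add_mul_mod_self_left]

/-- A point at angle `π (2 s + m - 1) / k` that lies in exactly the disks number
`s, …, s + m - 1`. -/
noncomputable def arcPoint (k : ℕ) (R : ℝ) (s m : ℕ) : Plane :=
  circlePoint 0 (Real.cos (Real.pi * m / k) +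
    √(Real.cos (Real.pi * m / k) ^ 2 + (R ^ 2 - 1))) (Real.pi * (2 * s + m - 1) / k)

/-- The radius `ρ` of `arcPoint` is the positive root of `ρ ^ 2 - 2 * ρ * γ + 1 = R ^ 2` with `γ =
cos (π m / k)`. By the law of cosines, a vertex at angular distance `δ` then has squared distance `R
^ 2 + 2 * ρ * (γ - cos δ)`. The direction is the middle of the arc of vertices `s, …, s + m - 1`:
these have `δ ≤ π (m - 1) / k`, the others `δ ≥ π (m + 1) / k`, and the threshold `π m / k` lies
between. -/
theorem exists_dist_arcPoint_sq {R : ℝ} (hR : 1 < R) (k s m : ℕ) : ∃ t : ℝ, 0 < t ∧ ∀ j : ℕ,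
    dist (arcPoint k R s m) (polygonVertex k (s + j)) ^ 2 = R ^ 2 +
      t * (Real.cos (Real.pi * m / k) - Real.cos (Real.pi * (m - 1 - 2 * j) / k)) := by
  set γ := Real.cos (Real.pi * m / k) with hγ
  have hpos : 0 < R ^ 2 - 1 := by nlinarith
  have hsq := Real.sq_sqrt (show 0 ≤ γ ^ 2 + (R ^ 2 - 1) by positivity)
  have hlt : -γ < √(γ ^ 2 + (R ^ 2 - 1)) :=
    Real.lt_sqrt_of_sq_lt (by linarith [neg_sq γ])
  set w := √(γ ^ 2 + (R ^ 2 - 1)) with hw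
  refine ⟨2 * (γ + w), by linarith, fun j => ?_⟩
  set θ := Real.pi * (2 * s + m - 1) / k with hθ
  set φ := 2 * Real.pi * ((s + j : ℕ) : ℝ) / k with hφ
  have hang : Real.pi * (m - 1 - 2 * j) / k = θ - φ := by
    rw [hθ, hφ]
    push_cast
    ring
  have h1 := Real.sin_sq_add_cos_sq θ
  have h2 := Real.sin_sq_add_cos_sq φ
  rw [hang, Real.cos_sub, EuclideanSpace.dist_eq, Real.sq_sqrt (by positivity)]
  simp only [Fin.sum_univ_two, Real.dist_eq, sq_abs, arcPoint, polygonVertex, circlePoint,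
    zero_add, PiLp.smul_apply, smul_eq_mul, ← hγ, ← hw, ← hθ, ← hφ, Matrix.cons_val_zero,
    Matrix.cons_val_one]
  linear_combination (γ + w) ^ 2 * h1 + h2 + hsq

theorem dist_arcPoint_lt {R : ℝ} (hR : 1 < R) {k m : ℕ} (s : ℕ) {j : ℕ} (hm : m < k)
    (hj : j < m) : dist (arcPoint k R s m) (polygonVertex k (s + j)) < R := by
  obtain ⟨t, ht, h⟩ := exists_dist_arcPoint_sq hR k s m
  have hk : (0 : ℝ) < k := by exact_mod_cast (Nat.zero_le m).trans_lt hm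
  have hmk : (m : ℝ) < k := by exact_mod_cast hm
  have hjm : (j : ℝ) + 1 ≤ m := by exact_mod_cast hj
  have hj0 : (0 : ℝ) ≤ j := j.cast_nonneg
  have hcos : Real.cos (Real.pi * m / k) < Real.cos (Real.pi * (m - 1 - 2 * j) / k) := by
    rw [← Real.cos_abs (Real.pi * (m - 1 - 2 * j) / k)]
    refine Real.cos_lt_cos_of_nonneg_of_le_pi (abs_nonneg _) ?_ ?_
    · rw [div_le_iff₀ hk]
      exact mul_le_mul_of_nonneg_left hmk.le Real.pi_pos.le
    · rw [abs_div, abs_mul, abs_of_pos Real.pi_pos, abs_of_pos hk]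
      gcongr
      rw [abs_lt]
      constructor <;> linarith
  refine lt_of_pow_lt_pow_left₀ 2 (by linarith) ?_
  rw [h j]
  nlinarith

theorem lt_dist_arcPoint {R : ℝ} (hR : 1 < R) {k m : ℕ} (s : ℕ) {j : ℕ} (hmj : m ≤ j)
    (hj : j < k) : R < dist (arcPoint k R s m) (polygonVertex k (s + j)) := by
  obtain ⟨t, ht, h⟩ := exists_dist_arcPoint_sq hR k s m
  have hk : (0 : ℝ) < k := by exact_mod_cast (Nat.zero_le j).trans_lt hj
  have hjk : (j : ℝ) + 1 ≤ k := by exact_mod_cast hj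
  have hjm : (m : ℝ) ≤ j := by exact_mod_cast hmj
  have hm0 : (0 : ℝ) ≤ m := m.cast_nonneg
  have hpi := Real.pi_pos
  have hcos : Real.cos (Real.pi * (m - 1 - 2 * j) / k) < Real.cos (Real.pi * m / k) := by
    have e : Real.pi * (m - 1 - 2 * j) / k = -(Real.pi * (2 * j + 1 - m) / k) := by ring
    rw [e, Real.cos_neg]
    rcases le_or_gt (2 * (j : ℝ) + 1 - m) k with hle | hgt
    · refine Real.cos_lt_cos_of_nonneg_of_le_pi (by positivity) ?_ ?_
      · rw [div_le_iff₀ hk]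
        exact mul_le_mul_of_nonneg_left hle hpi.le
      · gcongr
        linarith
    -- Beyond a half-turn the angle is measured the other way round; `j ≤ k - 1` leaves it at least
    -- `π (m + 1) / k`.
    · have e2 : Real.pi * (2 * j + 1 - m) / k =
          2 * Real.pi - Real.pi * (2 * k - (2 * j + 1 - m)) / k := by
        field_simp
        ring
      rw [e2, Real.cos_two_pi_sub]
      refine Real.cos_lt_cos_of_nonneg_of_le_pi (by positivity) ?_ ?_
      · rw [div_le_iff₀ hk]
        exact mul_le_mul_of_nonneg_left (by linarith) hpi.le
      · gcongr
        linarith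
  refine lt_of_pow_lt_pow_left₀ 2 dist_nonneg ?_
  rw [h j]
  nlinarith

theorem dist_zero_polygonVertex (k i : ℕ) : dist 0 (polygonVertex k i) = 1 := by
  rw [dist_zero_left, polygonVertex, EuclideanSpace.norm_eq]
  simp

/-- The parameters `(s, m)` of the proper nonempty cyclic intervals. -/
def arcIndex (k : ℕ) : Finset (ℕ × ℕ) :=
  Finset.range k ×ˢ Finset.Ico 1 k

/-- Distinct proper cyclic intervals differ at a vertex next to an endpoint. If the starts differ,
it is the later start or its predecessor; if they agree, it is the first vertex past the shorter
interval. -/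
theorem exists_separating_vertex {R : ℝ} (hR : 1 < R) {k : ℕ} {x y : ℕ × ℕ}
    (hx : x ∈ arcIndex k) (hy : y ∈ arcIndex k) (hxy : x ≠ y) :
    ∃ i : ℕ, ¬ (dist (arcPoint k R x.1 x.2) (polygonVertex k i) < R ↔
      dist (arcPoint k R y.1 y.2) (polygonVertex k i) < R) := by
  wlog hle : x.1 < y.1 ∨ (x.1 = y.1 ∧ x.2 < y.2) generalizing x y
  · obtain ⟨i, hi⟩ := this hy hx hxy.symm (by
      have : ¬ (x.1 = y.1 ∧ x.2 = y.2) := fun h => hxy (Prod.ext h.1 h.2)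
      omega)
    exact ⟨i, fun h => hi h.symm⟩
  obtain ⟨s', m'⟩ := x
  obtain ⟨s, m⟩ := y
  simp only [arcIndex, Finset.mem_product, Finset.mem_range, Finset.mem_Ico] at hx hy hle ⊢
  have hk : 1 ≤ k := by omega
  rcases hle with hlt | ⟨rfl, hlt⟩
  · obtain ⟨d, rfl⟩ : ∃ d, s = s' + (d + 1) := ⟨s - s' - 1, by omega⟩
    by_cases hd : d + 1 < m'
    · refine ⟨s' + d, fun h => ?_⟩
      have h1 := h.1 (dist_arcPoint_lt hR s' hx.2.2 (by omega))
      -- The predecessor of the start is the vertex with offset `k - 1`, outside the interval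
      -- because `m < k`.
      have h2 := lt_dist_arcPoint hR (k := k) (m := m) (s' + (d + 1)) (j := k - 1)
        (by omega) (by omega)
      have e : s' + (d + 1) + (k - 1) = s' + d + k := by omega
      rw [e, polygonVertex_add_self hk] at h2
      exact absurd h1 h2.not_gt
    · refine ⟨s' + (d + 1), fun h => ?_⟩
      have h1 := h.2 (dist_arcPoint_lt hR (s' + (d + 1)) (j := 0) hy.2.2 (by omega))
      have h2 := lt_dist_arcPoint hR (k := k) (m := m') s' (j := d + 1) (by omega) (by omega)
      exact absurd h1 h2.not_gt
  · refine ⟨s' + m', fun h => ?_⟩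
    have h1 := h.2 (dist_arcPoint_lt hR s' hy.2.2 hlt)
    have h2 := lt_dist_arcPoint hR (k := k) s' (le_refl m') (by omega)
    exact absurd h1 h2.not_gt

/-- The centres and radii of the disks `polygonDisks k ε`. -/
def polygonData (k : ℕ) (ε : ℝ) : Set (Plane × ℝ) :=
  {x | ∃ i < k, x = (polygonVertex k i, 1 + ε)}

theorem mem_polygonData {k : ℕ} (hk : 1 ≤ k) (ε : ℝ) (i : ℕ) :
    (polygonVertex k i, 1 + ε) ∈ polygonData k ε :=
  ⟨i % k, Nat.mod_lt _ hk, by rw [polygonVertex_mod hk]⟩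

theorem circles_polygonData (k : ℕ) (ε : ℝ) :
    circles (polygonData k ε) = polygonCircles k ε := by
  ext C
  constructor
  · rintro ⟨_, ⟨i, hi, rfl⟩, rfl⟩
    exact ⟨i, hi, rfl⟩
  · rintro ⟨i, hi, rfl⟩
    exact ⟨_, ⟨i, hi, rfl⟩, rfl⟩

/-- The origin lies in every disk, as `1 < 1 + ε`, while each arc point misses some disk. For `k =
1` there are no arc points and the origin alone remains. -/
theorem exists_circleSeparated_polygonData {k : ℕ} (hk : 1 ≤ k) {ε : ℝ} (hε : 0 < ε) :
    ∃ Q : Finset Plane, Q.card = k ^ 2 - k + 1 ∧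
      CircleSeparated (polygonData k ε) (↑Q : Set Plane) := by
  classical
  have hR : 1 < 1 + ε := by linarith
  set A : Finset Plane := (arcIndex k).image fun x => arcPoint k (1 + ε) x.1 x.2 with hA
  have hsep0 : ∀ x ∈ arcIndex k, ∃ i : ℕ,
      ¬ dist (arcPoint k (1 + ε) x.1 x.2) (polygonVertex k i) < 1 + ε := by
    intro x hx
    simp only [arcIndex, Finset.mem_product, Finset.mem_range, Finset.mem_Ico] at hx
    exact ⟨x.1 + x.2, (lt_dist_arcPoint hR x.1 le_rfl hx.2.2).not_gt⟩
  have hdist0 : ∀ i, dist 0 (polygonVertex k i) < 1 + ε := fun i => by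
    rw [dist_zero_polygonVertex]; exact hR
  have h0A : (0 : Plane) ∉ A := by
    intro h
    obtain ⟨x, hx, hx0⟩ := Finset.mem_image.1 h
    obtain ⟨i, hi⟩ := hsep0 x hx
    rw [hx0] at hi
    exact hi (hdist0 i)
  have hAcard : A.card = k * (k - 1) := by
    rw [hA, Finset.card_image_of_injOn, arcIndex, Finset.card_product, Finset.card_range,
      Nat.card_Ico]
    intro x hx y hy hxy
    by_contra hne
    obtain ⟨i, hi⟩ := exists_separating_vertex hR hx hy hne
    simp only at hxy
    rw [hxy] at hi
    exact hi Iff.rfl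
  refine ⟨insert 0 A, ?_, ?_, ?_, ?_⟩
  · rw [Finset.card_insert_of_notMem h0A, hAcard, Nat.mul_sub, pow_two, mul_one]
  · refine fun p hp => mem_compl_sUnion_circles.2 ?_
    rintro _ ⟨i, -, rfl⟩ hpi
    rcases Finset.mem_insert.1 (Finset.mem_coe.1 hp) with rfl | hp
    · exact (hdist0 i).ne hpi
    · obtain ⟨x, hx, rfl⟩ := Finset.mem_image.1 hp
      simp only [arcIndex, Finset.mem_product, Finset.mem_range, Finset.mem_Ico] at hx
      obtain ⟨j, hj, hji⟩ := exists_lt_polygonVertex_add_eq hk x.1 i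
      rw [← hji] at hpi
      rcases lt_or_ge j x.2 with h | h
      · exact (dist_arcPoint_lt hR x.1 hx.2.2 h).ne hpi
      · exact (lt_dist_arcPoint hR x.1 h hj).ne' hpi
  · intro p hp
    rcases Finset.mem_insert.1 (Finset.mem_coe.1 hp) with rfl | hp
    · exact ⟨_, mem_polygonData hk ε 0, hdist0 0⟩
    · obtain ⟨x, hx, rfl⟩ := Finset.mem_image.1 hp
      simp only [arcIndex, Finset.mem_product, Finset.mem_range, Finset.mem_Ico] at hx
      exact ⟨_, mem_polygonData hk ε _,
        dist_arcPoint_lt hR x.1 (j := 0) hx.2.2 (by omega)⟩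
  · intro p hp q hq hpq
    rcases Finset.mem_insert.1 (Finset.mem_coe.1 hp) with rfl | hp
    · rcases Finset.mem_insert.1 (Finset.mem_coe.1 hq) with rfl | hq
      · exact absurd rfl hpq
      · obtain ⟨y, hy, rfl⟩ := Finset.mem_image.1 hq
        obtain ⟨i, hi⟩ := hsep0 y hy
        exact ⟨_, mem_polygonData hk ε i, fun h => hi (h.1 (hdist0 i))⟩
    · obtain ⟨x, hx, rfl⟩ := Finset.mem_image.1 hp
      rcases Finset.mem_insert.1 (Finset.mem_coe.1 hq) with rfl | hq
      · obtain ⟨i, hi⟩ := hsep0 x hx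
        exact ⟨_, mem_polygonData hk ε i, fun h => hi (h.2 (hdist0 i))⟩
      · obtain ⟨y, hy, rfl⟩ := Finset.mem_image.1 hq
        obtain ⟨i, hi⟩ := exists_separating_vertex hR hx hy (fun h => hpq (by rw [h]))
        exact ⟨_, mem_polygonData hk ε i, hi⟩

/-! ### Optimality of the polygon disks -/

theorem encard_innerFaces_polygonCircles_le {k : ℕ} {ε : ℝ} (hε : 0 < ε) :
    (innerFaces (polygonCircles k ε)).encard ≤ ((k ^ 2 - k + 1 : ℕ) : ℕ∞) := by
  classical
  set Γ : Finset (Set Plane) :=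
    (Finset.range k).image fun i => Metric.sphere (polygonVertex k i) (1 + ε) with hΓ
  have hcoe : (Γ : Set (Set Plane)) = polygonCircles k ε := by
    ext C
    simp [hΓ, polygonCircles, eq_comm]
  have hcirc : ∀ C ∈ Γ, IsCircle C := by
    intro C hC
    obtain ⟨i, -, rfl⟩ := Finset.mem_image.1 hC
    exact ⟨_, _, by linarith, rfl⟩
  have hcard : Γ.card ≤ k := Finset.card_image_le.trans_eq (Finset.card_range k)
  rw [← hcoe]
  refine (encard_innerFaces_le Γ hcirc).trans (Nat.cast_le.2 ?_)
  have h3 : Γ.card * (Γ.card - 1) ≤ k * (k - 1) :=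
    Nat.mul_le_mul hcard (Nat.sub_le_sub_right hcard 1)
  rw [Nat.mul_sub, Nat.mul_sub, mul_one, mul_one, ← pow_two, ← pow_two] at h3
  omega

theorem CircleSeparated.identifies_polygonDisks {k : ℕ} {ε : ℝ} {P : Set Plane}
    (h : CircleSeparated (polygonData k ε) P) : Identifies (polygonDisks k ε) P := by
  have hmem : ∀ p ∈ P, ∀ i < k, p ∈ Metric.closedBall (polygonVertex k i) (1 + ε) ↔
      dist p (polygonVertex k i) < 1 + ε := by
    intro p hp i hi
    have hne := mem_compl_sUnion_circles.1 (h.avoids hp) (polygonVertex k i, 1 + ε) ⟨i, hi, rfl⟩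
    rw [Metric.mem_closedBall]
    exact ⟨fun h' => lt_of_le_of_ne h' hne, le_of_lt⟩
  refine ⟨fun p hp => ?_, fun p hp q hq hpq => ?_⟩
  · obtain ⟨_, ⟨i, hi, rfl⟩, hpi⟩ := h.covers p hp
    exact ⟨_, ⟨i, hi, rfl⟩, (hmem p hp i hi).2 hpi⟩
  · obtain ⟨_, ⟨i, hi, rfl⟩, hsep⟩ := h.separates p hp q hq hpq
    refine ⟨_, ⟨i, hi, rfl⟩, ?_⟩
    rw [xor_iff_not_iff, hmem p hp i hi, hmem q hq i hi]
    exact hsep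

theorem CircleSeparated.idNumber_eq {k : ℕ} {ε : ℝ} {P : Finset Plane}
    (h : CircleSeparated (polygonData k ε) (P : Set Plane)) (hP : P.Nonempty)
    (hk : k = diskBound P.card) : idNumber (P : Set Plane) = k := by
  classical
  refine le_antisymm ?_ (hk ▸ diskBound_le_idNumber hP)
  set D : Finset (Set Plane) :=
    (Finset.range k).image fun i => Metric.closedBall (polygonVertex k i) (1 + ε) with hD
  have hcoe : (D : Set (Set Plane)) = polygonDisks k ε := by
    ext C
    simp [hD, polygonDisks, eq_comm]
  refine (idNumber_le (D := D) ?_ (hcoe ▸ h.identifies_polygonDisks)).trans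
    (Finset.card_image_le.trans_eq (Finset.card_range k))
  intro d hd
  obtain ⟨i, -, rfl⟩ := Finset.mem_image.1 hd
  exact ⟨_, _, rfl⟩

theorem mainTheorem3 :
    -- the lower bound
    (∀ P : Finset Plane, P.Nonempty → diskBound P.card ≤ idNumber (↑P : Set Plane)) ∧
    -- `k` circles form at most `k² - k + 1` inner faces
    (∀ Γ : Finset (Set Plane), (∀ C ∈ Γ, IsCircle C) →
      (innerFaces (↑Γ : Set (Set Plane))).encard ≤ ((Γ.card ^ 2 - Γ.card + 1 : ℕ) : ℕ∞)) ∧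
    -- the lower bound is attained for every `n ≥ 1`
    (∀ n : ℕ, 1 ≤ n → ∃ P : Finset Plane,
      P.card = n ∧ idNumber (↑P : Set Plane) = diskBound n) ∧
    -- the disks on the regular `k`-gon: number of inner faces, and points in distinct inner faces
    (∀ k : ℕ, 1 ≤ k → ∀ ε : ℝ, 0 < ε →
      (innerFaces (polygonCircles k ε)).encard = ((k ^ 2 - k + 1 : ℕ) : ℕ∞) ∧
      ∀ P : Finset Plane,
        (∀ p ∈ P, ∃ F ∈ innerFaces (polygonCircles k ε), p ∈ F) →
        (∀ F ∈ innerFaces (polygonCircles k ε), ∀ p ∈ P, ∀ q ∈ P, p ∈ F → q ∈ F → p = q) →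
        Identifies (polygonDisks k ε) (↑P : Set Plane) ∧
        (P.Nonempty → k = diskBound P.card → idNumber (↑P : Set Plane) = k)) := by
  refine ⟨fun P hP => diskBound_le_idNumber hP, encard_innerFaces_le, fun n hn => ?_,
    fun k hk ε hε => ?_⟩
  · have hk := one_le_diskBound n
    obtain ⟨Q, hQ, hsep⟩ := exists_circleSeparated_polygonData hk one_pos
    have hn' : n ≤ Q.card := by
      rw [hQ]
      exact (diskBound_le_iff hk).1 le_rfl
    obtain ⟨P, hPQ, rfl⟩ := Finset.exists_subset_card_eq hn'
    exact ⟨P, rfl, (hsep.mono (Finset.coe_subset.2 hPQ)).idNumber_eq (Finset.card_pos.1 hn) rfl⟩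
  · obtain ⟨Q, hQ, hsep⟩ := exists_circleSeparated_polygonData hk hε
    have hle := encard_innerFaces_polygonCircles_le (k := k) hε
    refine ⟨le_antisymm hle ?_, fun P hP hPF => ?_⟩
    · rw [← hQ, ← circles_polygonData, ← encard_coe_eq_coe_finsetCard]
      exact hsep.encard_le
    · rw [← circles_polygonData] at hle hP hPF
      have hPsep := hsep.of_distinct_innerFaces (hQ ▸ hle) hP hPF
      exact ⟨hPsep.identifies_polygonDisks, hPsep.idNumber_eq⟩
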